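/- Let $A_1,\dots,A_m$ and $B$ be real symmetric $n\times n$ matrices and $c\in\mathbb R^m$. Write $\langle S,T\rangle=\operatorname{trace}(ST)$, $S\preceq T$ if $T-S$ is positive semidefinite (psd), and $\mathcal A^*Y=(\langle A_1,Y\rangle,\dots,\langle A_m,Y\rangle)^\top$. For a psd matrix $U$ put $$\tan(U)=\{W+W^\top : W\in\mathbb R^{n\times n},\ \mathcal R(W)\subseteq\mathcal R(U)\},$$ where $\mathcal R(M)$ denotes the range (column space) of the matrix $M$. Consider the primal semidefinite program $$(P)\qquad \sup\Big\{\textstyle\sum_{i=1}^m c_ix_i \;:\; x\in\mathbb R^m,\ \sum_{i=1}^m x_iA_i\preceq B\Big\}$$ and Ramana's extended dual $(D_{\rm Ram})$: minimize (infimum) $\langle B,\,U_{n+1}+V_{n+1}\rangle$ over real $n\times n$ matrices $U_0,V_0,\dots,U_{n+1},V_{n+1}$ subject to - $\mathcal A^*(U_{n+1}+V_{n+1})=c$; - $\mathcal A^*(U_i+V_i)=0$ and $\langle B,U_i+V_i\rangle=0$ for $i=1,\dots,n$; - $V_i\in\tan(U_{i-1})$ and $U_i$ is symmetric psd, for $i=1,\dots,n+1$;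 - $U_0=V_0=0$. Optimal values are taken in $[-\infty,+\infty]$, and the optimal value of an infimum problem is $+\infty$ if it is infeasible. Suppose that $(P)$ is feasible. Then $(P)$ and $(D_{\rm Ram})$ have the same optimal value, and the optimal value of $(D_{\rm Ram})$ is attained by a feasible solution whenever it is finite. -/

import Mathlib

open scoped Matrix

noncomputable section

namespace RamanaDual

/-- The trace inner product `⟨T, S⟩ = trace (T S)` of two matrices. -/
def inProd {n : ℕ} (T S : Matrix (Fin n) (Fin n) ℝ) : ℝ :=
  (T * S).trace

/-- The operator `𝒜 x = ∑ i, x i • A i`. -/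
def opA {m n : ℕ} (A : Fin m → Matrix (Fin n) (Fin n) ℝ) (x : Fin m → ℝ) :
    Matrix (Fin n) (Fin n) ℝ :=
  ∑ i, x i • A i

/-- The adjoint operator `𝒜* Y = (⟨A 1, Y⟩, …, ⟨A m, Y⟩)`. -/
def adjA {m n : ℕ} (A : Fin m → Matrix (Fin n) (Fin n) ℝ)
    (Y : Matrix (Fin n) (Fin n) ℝ) : Fin m → ℝ :=
  fun i => inProd (A i) Y

/-- The tangent space of the psd cone at `U`: all `W + Wᵀ` such that the range (column space)
of `W` is contained in that of `U`. -/
def tan {n : ℕ} (U : Matrix (Fin n) (Fin n) ℝ) : Set (Matrix (Fin n) (Fin n) ℝ) :=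
  {V | ∃ W : Matrix (Fin n) (Fin n) ℝ,
    LinearMap.range W.mulVecLin ≤ LinearMap.range U.mulVecLin ∧ V = W + Wᵀ}

/-- The feasible set of the primal problem: all `x` with `∑ i, x i • A i ⪯ B`. -/
def primalFeasible {m n : ℕ} (A : Fin m → Matrix (Fin n) (Fin n) ℝ)
    (B : Matrix (Fin n) (Fin n) ℝ) : Set (Fin m → ℝ) :=
  {x | (B - opA A x).PosSemidef}

/-- The optimal value in `[-∞, +∞]` of the primal problem `sup cᵀx` s.t. `∑ i, x i • A i ⪯ B`. -/
def valPrimal {m n : ℕ} (A : Fin m → Matrix (Fin n) (Fin n) ℝ)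
    (B : Matrix (Fin n) (Fin n) ℝ) (c : Fin m → ℝ) : EReal :=
  ⨆ x ∈ primalFeasible A B, ((∑ i, c i * x i : ℝ) : EReal)

/-- Feasibility of `(U 0, …, U (n+1), V 0, …, V (n+1))` in Ramana's dual. For `i : Fin n` the
index `i.succ.castSucc` runs through `1, …, n`; for `i : Fin (n + 1)` the index `i.succ` runs
through `1, …, n + 1` and `i.castSucc` is its predecessor; `Fin.last (n + 1)` is `n + 1`. -/
structure RamanaFeasible {m n : ℕ} (A : Fin m → Matrix (Fin n) (Fin n) ℝ)
    (B : Matrix (Fin n) (Fin n) ℝ) (c : Fin m → ℝ)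
    (U V : Fin (n + 2) → Matrix (Fin n) (Fin n) ℝ) : Prop where
  adj_last : adjA A (U (Fin.last (n + 1)) + V (Fin.last (n + 1))) = c
  adj_zero : ∀ i : Fin n, adjA A (U i.succ.castSucc + V i.succ.castSucc) = 0
  rhs_zero : ∀ i : Fin n, inProd B (U i.succ.castSucc + V i.succ.castSucc) = 0
  mem_tan : ∀ i : Fin (n + 1), V i.succ ∈ tan (U i.castSucc)
  psd : ∀ i : Fin (n + 1), (U i.succ).PosSemidef
  U_zero : U 0 = 0
  V_zero : V 0 = 0

/-- The objective function `⟨B, U (n+1) + V (n+1)⟩` of Ramana's dual. -/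
def ramanaObjective {n : ℕ} (B : Matrix (Fin n) (Fin n) ℝ)
    (U V : Fin (n + 2) → Matrix (Fin n) (Fin n) ℝ) : ℝ :=
  inProd B (U (Fin.last (n + 1)) + V (Fin.last (n + 1)))

/-- The optimal value in `[-∞, +∞]` of Ramana's dual (`+∞` if it is infeasible). -/
def valRamana {m n : ℕ} (A : Fin m → Matrix (Fin n) (Fin n) ℝ)
    (B : Matrix (Fin n) (Fin n) ℝ) (c : Fin m → ℝ) : EReal :=
  ⨅ (U : Fin (n + 2) → Matrix (Fin n) (Fin n) ℝ)
    (V : Fin (n + 2) → Matrix (Fin n) (Fin n) ℝ)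
    (_ : RamanaFeasible A B c U V), ((ramanaObjective B U V : ℝ) : EReal)

end RamanaDual

end

open Matrix

namespace RamanaDual

/-! ### Psd matrices, tangent spaces and kernels. -/

section Psd

variable {n : ℕ} {S T U V W Z : Matrix (Fin n) (Fin n) ℝ}

/-! Weak duality: every primal slack `S = B - opA A x` annihilates all `U i` with `i ≤ n`. Indeed `S
* U = 0` kills the pairing of `S` with `tan U`, so the next homogeneous constraints give `⟨S, U'⟩ =
0`, hence `S * U' = 0`. In the final stage `⟨S, V⟩ = 0` and `⟨S, U⟩ ≥ 0` bound the objective from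
below.

Strong duality with attainment is facial reduction. Let `v` bound the primal values and let `U` be
the current matrix. Psd `Z` with `U * Z = 0`, together with two scalars, form a cone with compact
base, so Hahn-Banach separates the image of the base from the subspace coming from `tan U` whenever
the two are disjoint. The separating functional would be a primal point with value above `v`, which
is impossible. A common point is an exact solution, so no closure is taken
(`exists_dual_or_reducing`): it gives either a dual solution of value at most `v` or a nonzero
reducing `Z`. Replacing `U` by `U + Z` strictly shrinks the kernel (`ker_add_lt`), so `n` reductions
suffice; `v` is finally the primal value itself. -/

lemma exists_eq_transpose_mul_self (hS : S.PosSemidef) :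
    ∃ C : Matrix (Fin n) (Fin n) ℝ, S = Cᵀ * C := by
  open scoped MatrixOrder in
  obtain ⟨C, hC⟩ := CStarAlgebra.nonneg_iff_eq_star_mul_self.mp hS.nonneg
  exact ⟨C, by simpa [star_eq_conjTranspose] using hC⟩

lemma isSymm_of_posSemidef (hS : S.PosSemidef) : S.IsSymm := by
  have := hS.isHermitian
  rwa [IsHermitian, conjTranspose_eq_transpose_of_trivial] at this

lemma trace_transpose_mul_mul (C D : Matrix (Fin n) (Fin n) ℝ) :
    ((Cᵀ * C) * (Dᵀ * D)).trace = ((C * Dᵀ)ᴴ * (C * Dᵀ)).trace := by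
  rw [conjTranspose_eq_transpose_of_trivial, transpose_mul, transpose_transpose,
    ← Matrix.mul_assoc (Cᵀ * C), trace_mul_comm _ D]
  simp only [Matrix.mul_assoc]

lemma inProd_nonneg (hS : S.PosSemidef) (hT : T.PosSemidef) : 0 ≤ inProd S T := by
  obtain ⟨C, rfl⟩ := exists_eq_transpose_mul_self hS
  obtain ⟨D, rfl⟩ := exists_eq_transpose_mul_self hT
  rw [inProd, trace_transpose_mul_mul]
  exact (posSemidef_conjTranspose_mul_self _).trace_nonneg

lemma mul_eq_zero_of_inProd_eq_zero (hS : S.PosSemidef) (hT : T.PosSemidef)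
    (h : inProd S T = 0) : S * T = 0 := by
  obtain ⟨C, rfl⟩ := exists_eq_transpose_mul_self hS
  obtain ⟨D, rfl⟩ := exists_eq_transpose_mul_self hT
  rw [inProd, trace_transpose_mul_mul, trace_conjTranspose_mul_self_eq_zero_iff] at h
  rw [Matrix.mul_assoc, ← Matrix.mul_assoc C, h]
  simp

lemma inProd_vecMulVec (T : Matrix (Fin n) (Fin n) ℝ) (q : Fin n → ℝ) :
    inProd T (vecMulVec q q) = q ⬝ᵥ (T *ᵥ q) := by
  rw [inProd, mul_vecMulVec, trace_vecMulVec, dotProduct_comm]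

lemma range_le_iff_exists_mul :
    LinearMap.range W.mulVecLin ≤ LinearMap.range U.mulVecLin ↔ ∃ X, W = U * X := by
  constructor
  · intro h
    have hc : ∀ j, ∃ y, U *ᵥ y = W *ᵥ Pi.single j 1 := fun j ↦ h ⟨_, rfl⟩
    choose y hy using hc
    refine ⟨.of fun i j ↦ y j i, ?_⟩
    ext i j
    have := congrFun (hy j) i
    rw [mulVec_single_one] at this
    exact this.symm
  · rintro ⟨X, rfl⟩ _ ⟨q, rfl⟩
    exact ⟨X *ᵥ q, by simp⟩

lemma mem_tan_iff : V ∈ tan U ↔ ∃ X, V = U * X + (U * X)ᵀ := by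
  simp only [tan, Set.mem_ofPred_eq, range_le_iff_exists_mul]
  constructor
  · rintro ⟨_, ⟨X, rfl⟩, rfl⟩
    exact ⟨X, rfl⟩
  · rintro ⟨X, rfl⟩
    exact ⟨_, ⟨X, rfl⟩, rfl⟩

/-- A symmetric `U` is half of itself plus half of its transpose, so subtracting it shifts the
factor `X` by half the identity. -/
lemma sub_self_mem_tan (hU : U.IsSymm) (hV : V ∈ tan U) : V - U ∈ tan U := by
  obtain ⟨X, rfl⟩ := mem_tan_iff.mp hV
  refine mem_tan_iff.mpr ⟨X - (1 / 2 : ℝ) • 1, ?_⟩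
  simp only [Matrix.mul_sub, Matrix.mul_smul, Matrix.mul_one, transpose_sub, transpose_smul, hU.eq]
  module

lemma smul_mem_tan (r : ℝ) (hV : V ∈ tan U) : r • V ∈ tan U := by
  obtain ⟨X, rfl⟩ := mem_tan_iff.mp hV
  exact mem_tan_iff.mpr ⟨r • X, by simp [smul_add]⟩

lemma neg_self_mem_tan (hU : U.IsSymm) : -U ∈ tan U := by
  have h0 : (0 : Matrix (Fin n) (Fin n) ℝ) ∈ tan U := mem_tan_iff.mpr ⟨0, by simp⟩
  simpa using sub_self_mem_tan hU h0

lemma inProd_eq_zero_of_mem_tan (hS : S.IsSymm) (h : S * U = 0) (hV : V ∈ tan U) :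
    inProd S V = 0 := by
  obtain ⟨X, rfl⟩ := mem_tan_iff.mp hV
  have h' : Uᵀ * S = 0 := by rw [← hS.eq, ← transpose_mul, h, transpose_zero]
  rw [inProd, Matrix.mul_add, ← Matrix.mul_assoc, h, trace_add, trace_mul_comm S, transpose_mul,
    Matrix.mul_assoc, h']
  simp

/-- Testing on the tangent vector generated by `U * (U * T)` yields twice the squared Frobenius norm
of `U * T`. -/
lemma mul_eq_zero_of_inProd_tan_eq_zero (hT : T.IsSymm) (hU : U.IsSymm)
    (h : ∀ V ∈ tan U, inProd T V = 0) : T * U = 0 := by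
  have key := h _ (mem_tan_iff.mpr ⟨U * T, rfl⟩)
  simp only [transpose_mul, hT.eq, hU.eq, inProd, Matrix.mul_add, trace_add] at key
  have h1 : (T * (U * (U * T))).trace = ((U * T)ᴴ * (U * T)).trace := by
    simp [conjTranspose_eq_transpose_of_trivial, hT.eq, hU.eq, Matrix.mul_assoc]
  have h2 : (T * (T * U * U)).trace = ((U * T)ᴴ * (U * T)).trace := by
    rw [← h1, trace_mul_comm T (U * (U * T)), ← trace_transpose (U * (U * T) * T)]
    simp [hT.eq, hU.eq, Matrix.mul_assoc]
  have h3 : U * T = 0 := trace_conjTranspose_mul_self_eq_zero_iff.mp (by linarith)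
  simpa [hT.eq, hU.eq] using congrArg transpose h3

/-- Since `U * (U + Z) = U * U`, the kernel of the sum lies in that of `U`. The columns of `Z` lie
in the kernel of `U`; if the kernels agreed, `Z * Z = 0` would follow. -/
lemma ker_add_lt (hU : U.IsSymm) (hZ : Z.IsSymm) (h : U * Z = 0) (hZ0 : Z ≠ 0) :
    LinearMap.ker (U + Z).mulVecLin < LinearMap.ker U.mulVecLin := by
  refine lt_of_le_of_ne (fun q hq ↦ ?_) fun he ↦ hZ0 ?_
  · rw [LinearMap.mem_ker, mulVecLin_apply] at hq ⊢
    have h1 : (Uᴴ * U) *ᵥ q = 0 := by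
      have := congrArg (U *ᵥ ·) hq
      simpa [Matrix.mul_add, h, conjTranspose_eq_transpose_of_trivial, hU.eq] using this
    exact (conjTranspose_mul_self_mulVec_eq_zero U q).mp h1
  · rw [← conjTranspose_mul_self_eq_zero, conjTranspose_eq_transpose_of_trivial, hZ.eq]
    refine ext_of_mulVec_single fun j ↦ ?_
    have hm : Z *ᵥ Pi.single j 1 ∈ LinearMap.ker U.mulVecLin := by
      rw [LinearMap.mem_ker, mulVecLin_apply, mulVec_mulVec, h, zero_mulVec]
    rw [← he, LinearMap.mem_ker, mulVecLin_apply, mulVec_mulVec, Matrix.add_mul, h,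
      zero_add] at hm
    rw [hm, zero_mulVec]

lemma isCompl_ker_range (hU : U.IsSymm) :
    IsCompl (LinearMap.ker U.mulVecLin) (LinearMap.range U.mulVecLin) := by
  refine (Submodule.isCompl_iff_disjoint _ _ ?_).mpr ?_
  · rw [add_comm, LinearMap.finrank_range_add_finrank_ker]
  · rw [Submodule.disjoint_def]
    rintro _ hk ⟨q, rfl⟩
    rw [LinearMap.mem_ker, mulVecLin_apply, mulVecLin_apply, mulVec_mulVec] at hk
    refine (conjTranspose_mul_self_mulVec_eq_zero U q).mp ?_
    rwa [conjTranspose_eq_transpose_of_trivial, hU.eq]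

/-- On the splitting of the space into kernel and range of `U`, only the kernel block of `T`
survives, and rank-one `Z` built from kernel vectors test it. Hence the cone may be restricted to `U
* Z = 0`. -/
lemma posSemidef_of_inProd_nonneg (hT : T.IsSymm) (hU : U.IsSymm) (h : T * U = 0)
    (hpos : ∀ Z : Matrix (Fin n) (Fin n) ℝ, Z.PosSemidef → U * Z = 0 → 0 ≤ inProd T Z) :
    T.PosSemidef := by
  refine .of_dotProduct_mulVec_nonneg
    (by rwa [IsHermitian, conjTranspose_eq_transpose_of_trivial]) fun q ↦ ?_
  obtain ⟨p, hp, r, ⟨w, rfl⟩, rfl⟩ :=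
    Submodule.mem_sup.mp ((isCompl_ker_range hU).sup_eq_top ▸ Submodule.mem_top (x := q))
  rw [LinearMap.mem_ker, mulVecLin_apply] at hp
  have h1 : T *ᵥ (p + U *ᵥ w) = T *ᵥ p := by
    rw [mulVec_add, mulVec_mulVec, h, zero_mulVec, add_zero]
  have h2 : U *ᵥ w ⬝ᵥ T *ᵥ p = 0 := by
    rw [dotProduct_mulVec, ← mulVec_transpose, hT.eq, mulVec_mulVec, h, zero_mulVec,
      zero_dotProduct]
  rw [star_trivial, mulVecLin_apply, h1, add_dotProduct, h2, add_zero, ← inProd_vecMulVec]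
  refine hpos _ ?_ ?_
  · simpa using posSemidef_vecMulVec_self_star p
  · rw [mul_vecMulVec, hp, zero_vecMulVec]

/-! ### Compactness of a base of the restricted psd cone. -/

lemma isClosed_posSemidef : IsClosed {S : Matrix (Fin n) (Fin n) ℝ | S.PosSemidef} := by
  simp only [posSemidef_iff_dotProduct_mulVec, Set.ofPred_and, Set.ofPred_forall, IsHermitian]
  exact (isClosed_eq (by fun_prop) (by fun_prop)).inter
    (isClosed_iInter fun q ↦ isClosed_le (by fun_prop) (by fun_prop))

lemma abs_apply_le_trace (hS : S.PosSemidef) (i j : Fin n) : |S i j| ≤ S.trace := by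
  have hd : ∀ k, S k k ≤ S.trace := fun k ↦
    Finset.single_le_sum (f := fun k ↦ S k k) (fun _ _ ↦ hS.diag_nonneg) (Finset.mem_univ k)
  have hs : S j i = S i j := (isSymm_of_posSemidef hS).apply i j
  have hp := hS.dotProduct_mulVec_nonneg (Pi.single i 1 + Pi.single j 1)
  have hm := hS.dotProduct_mulVec_nonneg (Pi.single i 1 - Pi.single j 1)
  simp only [star_trivial, mulVec_add, mulVec_sub, mulVec_single_one, add_dotProduct,
    sub_dotProduct, single_one_dotProduct, Pi.add_apply, Pi.sub_apply, col_apply] at hp hm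
  rw [abs_le]
  constructor <;> linarith [hd i, hd j]

/-- A compact base of the cone of all `(Z, s, r)` with `Z` psd, `U Z = 0` and `s, r ≥ 0`. -/
def coneBase (U : Matrix (Fin n) (Fin n) ℝ) : Set (Matrix (Fin n) (Fin n) ℝ × ℝ × ℝ) :=
  {p | p.1.PosSemidef ∧ U * p.1 = 0 ∧ 0 ≤ p.2.1 ∧ 0 ≤ p.2.2 ∧ p.1.trace + p.2.1 + p.2.2 = 1}

lemma convex_coneBase : Convex ℝ (coneBase U) := by
  rintro ⟨Z, s, r⟩ ⟨hZ, hUZ, hs, hr, h1⟩ ⟨Z', s', r'⟩ ⟨hZ', hUZ', hs', hr', h1'⟩ a b ha hb hab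
  refine ⟨(hZ.smul ha).add (hZ'.smul hb), ?_, ?_, ?_, ?_⟩ <;>
    simp only [Prod.smul_mk, Prod.mk_add_mk, smul_eq_mul] at *
  · simp [Matrix.mul_add, hUZ, hUZ']
  · positivity
  · positivity
  · rw [trace_add, trace_smul, trace_smul, smul_eq_mul, smul_eq_mul]
    linear_combination a * h1 + b * h1' + hab

lemma isCompact_coneBase : IsCompact (coneBase U) := by
  have hbox : IsCompact ((Set.univ.pi fun _ : Fin n ↦ Set.univ.pi fun _ : Fin n ↦
      Set.Icc (-1 : ℝ) 1) ×ˢ Set.Icc (0 : ℝ) 1 ×ˢ Set.Icc (0 : ℝ) 1) :=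
    (isCompact_univ_pi fun _ ↦ isCompact_univ_pi fun _ ↦ isCompact_Icc).prod
      (isCompact_Icc.prod isCompact_Icc)
  refine IsCompact.of_isClosed_subset hbox ?_ ?_
  · have hset : coneBase U = Prod.fst ⁻¹' {Z | Z.PosSemidef} ∩ ({p | U * p.1 = 0} ∩
        ({p | 0 ≤ p.2.1} ∩ ({p | 0 ≤ p.2.2} ∩ {p | p.1.trace + p.2.1 + p.2.2 = 1}))) := by
      ext
      rfl
    have htr : Continuous fun p : Matrix (Fin n) (Fin n) ℝ × ℝ × ℝ ↦ p.1.trace :=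
      continuous_fst.matrix_trace
    rw [hset]
    exact (isClosed_posSemidef.preimage continuous_fst).inter <|
      (isClosed_eq (by fun_prop) (by fun_prop)).inter <|
      (isClosed_le (by fun_prop) (by fun_prop)).inter <|
      (isClosed_le (by fun_prop) (by fun_prop)).inter <|
      isClosed_eq (by fun_prop) (by fun_prop)
  · rintro ⟨Z, s, r⟩ ⟨hZ, -, hs, hr, h1⟩
    have ht := hZ.trace_nonneg
    simp only at hZ hs hr h1 ht
    refine ⟨fun i _ j _ ↦ abs_le.mp ((abs_apply_le_trace hZ i j).trans (by linarith)),
      ⟨hs, by linarith⟩, hr, by linarith⟩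

end Psd

/-! ### The constraint map and weak duality. -/

section Duality

variable {m n : ℕ} {A : Fin m → Matrix (Fin n) (Fin n) ℝ} {B : Matrix (Fin n) (Fin n) ℝ}
  {c x : Fin m → ℝ} {U V Z : Matrix (Fin n) (Fin n) ℝ}

/-- The linear map `Y ↦ (𝒜* Y, ⟨B, Y⟩)`. -/
def adjPair (A : Fin m → Matrix (Fin n) (Fin n) ℝ) (B : Matrix (Fin n) (Fin n) ℝ) :
    Matrix (Fin n) (Fin n) ℝ →ₗ[ℝ] (Fin m → ℝ) × ℝ where
  toFun Y := (adjA A Y, inProd B Y)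
  map_add' Y Y' := by
    ext <;> simp [adjA, inProd, Matrix.mul_add]
  map_smul' r Y := by
    ext <;> simp [adjA, inProd]

lemma adjPair_apply (Y : Matrix (Fin n) (Fin n) ℝ) :
    adjPair A B Y = (adjA A Y, inProd B Y) := rfl

lemma inProd_opA (x : Fin m → ℝ) (Y : Matrix (Fin n) (Fin n) ℝ) :
    inProd (opA A x) Y = ∑ i, adjA A Y i * x i := by
  simp [inProd, opA, adjA, Finset.sum_mul, trace_sum, mul_comm]

lemma inProd_slack (x : Fin m → ℝ) (Y : Matrix (Fin n) (Fin n) ℝ) :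
    inProd (B - opA A x) Y = inProd B Y - ∑ i, adjA A Y i * x i := by
  rw [← inProd_opA]
  simp [inProd, Matrix.sub_mul]

lemma inProd_add_right (S Y Y' : Matrix (Fin n) (Fin n) ℝ) :
    inProd S (Y + Y') = inProd S Y + inProd S Y' := by
  simp [inProd, Matrix.mul_add]

lemma slack_mul_eq_zero (hx : x ∈ primalFeasible A B) (hU : (B - opA A x) * U = 0)
    (hV : V ∈ tan U) (hZ : Z.PosSemidef) (hadj : adjA A (Z + V) = 0)
    (hrhs : inProd B (Z + V) = 0) : (B - opA A x) * Z = 0 := by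
  refine mul_eq_zero_of_inProd_eq_zero hx hZ ?_
  have h := inProd_slack (A := A) (B := B) x (Z + V)
  rw [inProd_add_right, inProd_eq_zero_of_mem_tan (isSymm_of_posSemidef hx) hU hV, hrhs,
    hadj] at h
  simpa using h

lemma objective_le_of_slack_mul_eq_zero (hx : x ∈ primalFeasible A B)
    (hU : (B - opA A x) * U = 0) (hV : V ∈ tan U) (hZ : Z.PosSemidef)
    (hadj : adjA A (Z + V) = c) : ∑ i, c i * x i ≤ inProd B (Z + V) := by
  have h := inProd_slack (A := A) (B := B) x (Z + V)
  rw [inProd_add_right, inProd_eq_zero_of_mem_tan (isSymm_of_posSemidef hx) hU hV, hadj] at h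
  linarith [inProd_nonneg hx hZ]

lemma RamanaFeasible.slack_mul_eq_zero {U V : Fin (n + 2) → Matrix (Fin n) (Fin n) ℝ}
    (h : RamanaFeasible A B c U V) (hx : x ∈ primalFeasible A B) (i : Fin (n + 1)) :
    (B - opA A x) * U i.castSucc = 0 := by
  induction i using Fin.induction with
  | zero => simp [h.U_zero]
  | succ i ih =>
    exact RamanaDual.slack_mul_eq_zero hx ih (h.mem_tan i.castSucc) (h.psd i.castSucc)
      (h.adj_zero i) (h.rhs_zero i)

lemma RamanaFeasible.weak_duality {U V : Fin (n + 2) → Matrix (Fin n) (Fin n) ℝ}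
    (h : RamanaFeasible A B c U V) (hx : x ∈ primalFeasible A B) :
    ∑ i, c i * x i ≤ ramanaObjective B U V :=
  objective_le_of_slack_mul_eq_zero hx (h.slack_mul_eq_zero hx (Fin.last n))
    (h.mem_tan (Fin.last n)) (h.psd (Fin.last n)) h.adj_last

/-! ### Separation and the resulting alternative. -/

lemma opA_isSymm (hA : ∀ i, (A i).IsSymm) (x : Fin m → ℝ) : (opA A x).IsSymm := by
  simp only [IsSymm, opA, transpose_sum, transpose_smul, (hA _).eq]

/-- The linear map `(Z, s, r) ↦ (𝒜* Z - r c, ⟨B, Z⟩ + s - r v)`. -/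
def conePair (A : Fin m → Matrix (Fin n) (Fin n) ℝ) (B : Matrix (Fin n) (Fin n) ℝ)
    (c : Fin m → ℝ) (v : ℝ) : Matrix (Fin n) (Fin n) ℝ × ℝ × ℝ →ₗ[ℝ] (Fin m → ℝ) × ℝ :=
  (adjPair A B).coprod (.coprod (LinearMap.toSpanSingleton ℝ _ (0, 1))
    (LinearMap.toSpanSingleton ℝ _ (-c, -v)))

lemma conePair_apply (v : ℝ) (Z : Matrix (Fin n) (Fin n) ℝ) (s r : ℝ) :
    conePair A B c v (Z, s, r) = adjPair A B Z + (s • (0, 1) + r • (-c, -v)) := rfl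

/-- The image of `tan U` under `Y ↦ (𝒜* Y, ⟨B, Y⟩)`. -/
def tanPair (A : Fin m → Matrix (Fin n) (Fin n) ℝ) (B U : Matrix (Fin n) (Fin n) ℝ) :
    Submodule ℝ ((Fin m → ℝ) × ℝ) :=
  LinearMap.range (adjPair A B ∘ₗ (LinearMap.mulLeft ℝ U +
    (transposeLinearEquiv (Fin n) (Fin n) ℝ ℝ).toLinearMap ∘ₗ LinearMap.mulLeft ℝ U))

lemma mem_tanPair {p : (Fin m → ℝ) × ℝ} :
    p ∈ tanPair A B U ↔ ∃ V ∈ tan U, adjPair A B V = p := by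
  constructor
  · rintro ⟨X, rfl⟩
    exact ⟨_, mem_tan_iff.mpr ⟨X, rfl⟩, rfl⟩
  · rintro ⟨V, hV, rfl⟩
    obtain ⟨X, rfl⟩ := mem_tan_iff.mp hV
    exact ⟨X, rfl⟩

lemma dual_apply_eq (f : StrongDual ℝ ((Fin m → ℝ) × ℝ)) (a : Fin m → ℝ) (b : ℝ) :
    f (a, b) = ∑ i, a i * f (Pi.single i 1, 0) + b * f (0, 1) := by
  have h : ((a, b) : (Fin m → ℝ) × ℝ) =
      (∑ i, a i • ((Pi.single i 1, 0) : (Fin m → ℝ) × ℝ)) + b • (0, 1) := by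
    ext j <;> simp [Prod.fst_sum, Prod.snd_sum, Finset.sum_apply, Pi.single_apply]
  rw [h, map_add, map_sum, map_smul, smul_eq_mul]
  congr 1
  exact Finset.sum_congr rfl fun i _ ↦ by rw [map_smul, smul_eq_mul]

/-- If the generators `conePair '' coneBase U` can be separated from `tanPair A B U`, the
separating functional yields a primal feasible point with objective value above `v`. -/
lemma exists_primal_of_disjoint (hA : ∀ i, (A i).IsSymm) (hB : B.IsSymm) {v : ℝ}
    (hU : U.IsSymm)
    (h : Disjoint (conePair A B c v '' coneBase U) (tanPair A B U : Set ((Fin m → ℝ) × ℝ))) :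
    ∃ x ∈ primalFeasible A B, v < ∑ i, c i * x i := by
  obtain ⟨f, u, w, hfu, huw, hfw⟩ := geometric_hahn_banach_compact_closed
    (convex_coneBase.linear_image (conePair A B c v))
    (isCompact_coneBase.image (LinearMap.continuous_of_finiteDimensional _))
    (tanPair A B U).convex (tanPair A B U).closed_of_finiteDimensional h
  have hw : w < 0 := by simpa using hfw 0 (tanPair A B U).zero_mem
  have hneg : ∀ p ∈ coneBase U, f (conePair A B c v p) < 0 := fun p hp ↦
    ((hfu _ ⟨p, hp, rfl⟩).trans huw).trans hw
  have hzero : ∀ p ∈ tanPair A B U, f p = 0 := by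
    intro p hp
    by_contra hne
    -- If `f p ≠ 0`, a multiple of `p` takes the value `w` exactly, against the strict bound on the
    -- subspace.
    have := hfw _ ((tanPair A B U).smul_mem (w / f p) hp)
    rw [map_smul, smul_eq_mul, div_mul_cancel₀ _ hne] at this
    exact lt_irrefl _ this
  set t := f (0, 1)
  set y : Fin m → ℝ := fun i ↦ f (Pi.single i 1, 0)
  have hf : ∀ Y, f (adjPair A B Y) = inProd (opA A y + t • B) Y := by
    intro Y
    have : inProd (opA A y + t • B) Y = inProd (opA A y) Y + inProd B Y * t := by
      simp [inProd, Matrix.add_mul, mul_comm]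
    rw [this, inProd_opA, adjPair_apply, dual_apply_eq]
  have ht0 : t < 0 := by
    -- The `s`-generator makes the coefficient of `B` negative, so dividing by it is allowed; the
    -- `r`-generator then compares the objective with `v`.
    have := hneg (0, 1, 0) ⟨.zero, by simp, by simp, by simp, by simp⟩
    simpa [conePair_apply] using this
  have hobj : -∑ i, c i * y i - v * t < 0 := by
    have := hneg (0, 0, 1) ⟨.zero, by simp, by simp, by simp, by simp⟩
    rw [conePair_apply, map_zero, zero_smul, zero_add, zero_add, one_smul, dual_apply_eq] at this
    simp only [Pi.neg_apply, neg_mul, Finset.sum_neg_distrib] at this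
    linarith
  set T := B - opA A (fun i ↦ -(t⁻¹ * y i)) with hT
  have hTe : T = t⁻¹ • (opA A y + t • B) := by
    have : opA A (fun i ↦ -(t⁻¹ * y i)) = -(t⁻¹ • opA A y) := by
      simp [opA, Finset.smul_sum, mul_smul]
    rw [hT, this, smul_add, smul_smul, inv_mul_cancel₀ ht0.ne, one_smul]
    abel
  have hTY : ∀ Y, inProd T Y = t⁻¹ * f (adjPair A B Y) := by
    intro Y
    rw [hf, hTe, inProd, Matrix.smul_mul, trace_smul, smul_eq_mul, inProd]
  have hTs : T.IsSymm := hB.sub (opA_isSymm hA _)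
  have hTU : T * U = 0 := mul_eq_zero_of_inProd_tan_eq_zero hTs hU fun V hV ↦ by
    rw [hTY, hzero _ (mem_tanPair.mpr ⟨V, hV, rfl⟩), mul_zero]
  refine ⟨fun i ↦ -(t⁻¹ * y i), posSemidef_of_inProd_nonneg hTs hU hTU fun Z hZ hUZ ↦ ?_, ?_⟩
  · rcases eq_or_ne Z 0 with rfl | hZ0
    · simp [inProd]
    have htr : 0 < Z.trace :=
      lt_of_le_of_ne hZ.trace_nonneg fun h ↦ hZ0 (hZ.trace_eq_zero_iff.mp h.symm)
    have hn := hneg (Z.trace⁻¹ • Z, 0, 0) ⟨hZ.smul (inv_nonneg.mpr htr.le), by simp [hUZ],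
      by simp, by simp, by simp [htr.ne']⟩
    rw [conePair_apply, zero_smul, zero_smul, add_zero, add_zero, map_smul, map_smul,
      smul_eq_mul] at hn
    rw [hTY]
    have := neg_of_mul_neg_right hn (inv_nonneg.mpr htr.le)
    exact (mul_pos_of_neg_of_neg (inv_lt_zero.mpr ht0) this).le
  · have hs : ∑ i, c i * -(t⁻¹ * y i) = -(∑ i, c i * y i) / t := by
      rw [div_eq_mul_inv, neg_mul, Finset.sum_mul, ← Finset.sum_neg_distrib]
      exact Finset.sum_congr rfl fun i _ ↦ by ring
    rw [hs, lt_div_iff_of_neg ht0]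
    linarith

/-- By separation the two sets meet, giving `(Z, s, r)` and `V` with `adjPair A B (Z + V) = (r • c,
r * v - s)`. If `r > 0`, dividing by `r` gives the dual solution. If `r = 0`, weak duality with `c =
0` forces `s = 0`, and the normalization of the base forces `Z ≠ 0`. -/
lemma exists_dual_or_reducing (hA : ∀ i, (A i).IsSymm) (hB : B.IsSymm)
    (hx : x ∈ primalFeasible A B) {v : ℝ}
    (hv : ∀ x ∈ primalFeasible A B, ∑ i, c i * x i ≤ v) (hU : U.IsSymm)
    (hSU : (B - opA A x) * U = 0) :
    (∃ Z V, Z.PosSemidef ∧ V ∈ tan U ∧ adjA A (Z + V) = c ∧ inProd B (Z + V) ≤ v) ∨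
    ∃ Z V, Z.PosSemidef ∧ V ∈ tan U ∧ U * Z = 0 ∧ Z ≠ 0 ∧ adjA A (Z + V) = 0 ∧
      inProd B (Z + V) = 0 := by
  by_cases hd : Disjoint (conePair A B c v '' coneBase U)
      (tanPair A B U : Set ((Fin m → ℝ) × ℝ))
  · obtain ⟨y, hy, hlt⟩ := exists_primal_of_disjoint hA hB hU hd
    exact absurd (hv y hy) hlt.not_ge
  obtain ⟨_, ⟨⟨Z, s, r⟩, ⟨hZ, hUZ, hs, hr, h1⟩, rfl⟩, hp⟩ := Set.not_disjoint_iff.mp hd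
  simp only at hZ hUZ hs hr h1
  obtain ⟨V', hV', he⟩ := mem_tanPair.mp hp
  obtain ⟨V, hV, rfl⟩ : ∃ V ∈ tan U, V' = -V :=
    ⟨-V', by simpa using smul_mem_tan (-1) hV', by simp⟩
  have hpair : adjPair A B (Z + V) = (r • c, r * v - s) := by
    rw [conePair_apply, map_neg, neg_eq_iff_add_eq_zero] at he
    rw [map_add, ← sub_eq_zero, ← he]
    ext <;> simp <;> ring
  rcases hr.eq_or_lt with rfl | hr0
  · rw [adjPair_apply] at hpair
    simp only [zero_smul, zero_mul, zero_sub, Prod.mk.injEq] at hpair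
    obtain ⟨hadj, hrhs⟩ := hpair
    have hw := objective_le_of_slack_mul_eq_zero hx hSU hV hZ hadj
    simp only [Pi.zero_apply, zero_mul, Finset.sum_const_zero] at hw
    have hs0 : s = 0 := by linarith
    refine .inr ⟨Z, V, hZ, hV, hUZ, ?_, hadj, by rw [hrhs, hs0, neg_zero]⟩
    rintro rfl
    simp [hs0] at h1
  · have hinv : adjPair A B (r⁻¹ • Z + r⁻¹ • V) = r⁻¹ • (r • c, r * v - s) := by
      rw [← smul_add, map_smul, hpair]
    simp only [adjPair_apply, Prod.smul_mk, smul_smul,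
      inv_mul_cancel₀ hr0.ne', one_smul, Prod.mk.injEq] at hinv
    refine .inl ⟨r⁻¹ • Z, r⁻¹ • V, hZ.smul (inv_nonneg.mpr hr), smul_mem_tan _ hV, hinv.1, ?_⟩
    rw [hinv.2, smul_eq_mul, mul_sub, ← mul_assoc, inv_mul_cancel₀ hr0.ne', one_mul]
    have : 0 ≤ r⁻¹ * s := mul_nonneg (inv_nonneg.mpr hr) hs
    linarith

/-! ### Facial reduction. -/

/-- `(Us, Vs)` satisfies the constraints of Ramana's dual up to index `k`, apart from those
that involve `c`. -/
structure FacialChain (A : Fin m → Matrix (Fin n) (Fin n) ℝ) (B : Matrix (Fin n) (Fin n) ℝ)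
    (k : ℕ) (Us Vs : ℕ → Matrix (Fin n) (Fin n) ℝ) : Prop where
  U_zero : Us 0 = 0
  V_zero : Vs 0 = 0
  adj_zero : ∀ i < k, adjA A (Us (i + 1) + Vs (i + 1)) = 0
  rhs_zero : ∀ i < k, inProd B (Us (i + 1) + Vs (i + 1)) = 0
  mem_tan : ∀ i < k, Vs (i + 1) ∈ tan (Us i)
  psd : ∀ i ≤ k, (Us i).PosSemidef

lemma FacialChain.slack_mul_eq_zero {k : ℕ} {Us Vs : ℕ → Matrix (Fin n) (Fin n) ℝ}
    (h : FacialChain A B k Us Vs) (hx : x ∈ primalFeasible A B) :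
    ∀ i ≤ k, (B - opA A x) * Us i = 0
  | 0, _ => by simp [h.U_zero]
  | i + 1, hi => RamanaDual.slack_mul_eq_zero hx (h.slack_mul_eq_zero hx i (by omega))
      (h.mem_tan i hi) (h.psd _ hi) (h.adj_zero i hi) (h.rhs_zero i hi)

lemma FacialChain.extend {k : ℕ} {Us Vs : ℕ → Matrix (Fin n) (Fin n) ℝ}
    (h : FacialChain A B k Us Vs) (hZ : Z.PosSemidef) (hV : V ∈ tan (Us k))
    (hadj : adjA A (Z + V) = 0) (hrhs : inProd B (Z + V) = 0) :
    FacialChain A B (k + 1) (Function.update Us (k + 1) Z) (Function.update Vs (k + 1) V) where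
  U_zero := by simp [h.U_zero]
  V_zero := by simp [h.V_zero]
  adj_zero i hi := by
    rcases Nat.lt_succ_iff_lt_or_eq.mp hi with hi | rfl
    · simpa [hi.ne] using h.adj_zero i hi
    · simpa using hadj
  rhs_zero i hi := by
    rcases Nat.lt_succ_iff_lt_or_eq.mp hi with hi | rfl
    · simpa [hi.ne] using h.rhs_zero i hi
    · simpa using hrhs
  mem_tan i hi := by
    rcases Nat.lt_succ_iff_lt_or_eq.mp hi with hi | rfl
    · simpa [hi.ne, (hi.trans k.lt_succ_self).ne] using h.mem_tan i hi
    · simpa using hV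
  psd i hi := by
    rcases Nat.le_succ_iff.mp hi with hi | rfl
    · simpa [(Nat.lt_succ_of_le hi).ne] using h.psd i hi
    · simpa using hZ

lemma FacialChain.ramanaFeasible {Us Vs : ℕ → Matrix (Fin n) (Fin n) ℝ}
    (h : FacialChain A B n Us Vs) (hZ : Z.PosSemidef) (hV : V ∈ tan (Us n))
    (hadj : adjA A (Z + V) = c) :
    RamanaFeasible A B c (fun i ↦ Function.update Us (n + 1) Z i)
      (fun i ↦ Function.update Vs (n + 1) V i) where
  adj_last := by simpa using hadj
  adj_zero i := by simpa [i.2.ne] using h.adj_zero i i.2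
  rhs_zero i := by simpa [i.2.ne] using h.rhs_zero i i.2
  mem_tan i := by
    rcases Nat.lt_succ_iff_lt_or_eq.mp i.2 with hi | hi
    · simpa [hi.ne, i.2.ne] using h.mem_tan i hi
    · simpa [hi] using hV
  psd i := by
    rcases Nat.lt_succ_iff_lt_or_eq.mp i.2 with hi | hi
    · simpa [hi.ne] using h.psd (i + 1) hi
    · simpa [hi] using hZ
  U_zero := by simpa using h.U_zero
  V_zero := by simpa using h.V_zero

/-- Facial reduction: after `k` steps either the dual over the current face attains the value
`v`, or the kernel of the last matrix has dimension at most `n - k`. -/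
lemma exists_facialChain (hA : ∀ i, (A i).IsSymm) (hB : B.IsSymm)
    (hx : x ∈ primalFeasible A B) {v : ℝ}
    (hv : ∀ x ∈ primalFeasible A B, ∑ i, c i * x i ≤ v) (k : ℕ) :
    ∃ Us Vs, FacialChain A B k Us Vs ∧
      ((∃ Z V, Z.PosSemidef ∧ V ∈ tan (Us k) ∧ adjA A (Z + V) = c ∧ inProd B (Z + V) ≤ v) ∨
        Module.finrank ℝ (LinearMap.ker (Us k).mulVecLin) + k ≤ n) := by
  induction k with
  | zero =>
    refine ⟨0, 0, ⟨rfl, rfl, by simp, by simp, by simp, fun _ _ ↦ .zero⟩, .inr ?_⟩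
    simpa using Submodule.finrank_le (LinearMap.ker (0 : Matrix (Fin n) (Fin n) ℝ).mulVecLin)
  | succ k ih =>
    obtain ⟨Us, Vs, hc, hk⟩ := ih
    have hUk := hc.psd k le_rfl
    have hUs := isSymm_of_posSemidef hUk
    -- Idle step: repeating `Us k` with tangent part `-Us k` has sum zero, which pads a chain to
    -- full length.
    have hpad := hc.extend hUk (neg_self_mem_tan hUs)
      (by rw [add_neg_cancel]; ext; simp [adjA, inProd]) (by simp [inProd])
    rcases hk with hgood | hk
    · exact ⟨_, _, hpad, .inl (by simpa using hgood)⟩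
    rcases exists_dual_or_reducing hA hB hx hv hUs (hc.slack_mul_eq_zero hx k le_rfl) with
      hgood | ⟨Z, V, hZ, hV, hUZ, hZ0, hadj, hrhs⟩
    · exact ⟨_, _, hpad, .inl (by simpa using hgood)⟩
    -- Passing to `Us k + Z` accumulates the kernel loss; the tangent part absorbs `-Us k`, so the
    -- constrained sum is unchanged.
    have hsum : Us k + Z + (V - Us k) = Z + V := by abel
    refine ⟨_, _, hc.extend (hUk.add hZ) (sub_self_mem_tan hUs hV) (hsum ▸ hadj) (hsum ▸ hrhs),
      .inr ?_⟩
    have hlt := Submodule.finrank_lt_finrank_of_lt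
      (ker_add_lt hUs (isSymm_of_posSemidef hZ) hUZ hZ0)
    rw [Function.update_self]
    omega

lemma exists_ramanaFeasible_le (hA : ∀ i, (A i).IsSymm) (hB : B.IsSymm)
    (hx : x ∈ primalFeasible A B) {v : ℝ}
    (hv : ∀ x ∈ primalFeasible A B, ∑ i, c i * x i ≤ v) :
    ∃ U V, RamanaFeasible A B c U V ∧ ramanaObjective B U V ≤ v := by
  obtain ⟨Us, Vs, hc, hk⟩ := exists_facialChain hA hB hx hv n
  have hUs := isSymm_of_posSemidef (hc.psd n le_rfl)
  obtain ⟨Z, V, hZ, hV, hadj, hle⟩ : ∃ Z V, Z.PosSemidef ∧ V ∈ tan (Us n) ∧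
      adjA A (Z + V) = c ∧ inProd B (Z + V) ≤ v := by
    refine hk.elim id fun hk ↦ ?_
    refine (exists_dual_or_reducing hA hB hx hv hUs
      (hc.slack_mul_eq_zero hx n le_rfl)).resolve_right ?_
    -- After `n` steps the kernel is trivial and cannot shrink further.
    rintro ⟨Z, V, hZ, -, hUZ, hZ0, -⟩
    have := Submodule.finrank_lt_finrank_of_lt
      (ker_add_lt hUs (isSymm_of_posSemidef hZ) hUZ hZ0)
    omega
  exact ⟨_, _, hc.ramanaFeasible hZ hV hadj, by simpa [ramanaObjective] using hle⟩

/-! ### Comparison of the extended optimal values. -/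

lemma valPrimal_le_valRamana : valPrimal A B c ≤ valRamana A B c :=
  iSup₂_le fun _ hx ↦ le_iInf₂ fun _ _ ↦ le_iInf fun h ↦
    EReal.coe_le_coe_iff.mpr (h.weak_duality hx)

lemma exists_ramanaFeasible_le_valPrimal (hA : ∀ i, (A i).IsSymm) (hB : B.IsSymm)
    (hx : x ∈ primalFeasible A B) (htop : valPrimal A B c ≠ ⊤) :
    ∃ U V, RamanaFeasible A B c U V ∧ ((ramanaObjective B U V : ℝ) : EReal) ≤ valPrimal A B c := by
  have hle : ∀ y ∈ primalFeasible A B, ((∑ i, c i * y i : ℝ) : EReal) ≤ valPrimal A B c :=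
    fun y hy ↦ le_iSup₂ (f := fun y (_ : y ∈ primalFeasible A B) ↦
      ((∑ i, c i * y i : ℝ) : EReal)) y hy
  have hbot : valPrimal A B c ≠ ⊥ := ((EReal.bot_lt_coe _).trans_le (hle x hx)).ne'
  lift valPrimal A B c to ℝ using ⟨htop, hbot⟩ with v
  simp only [EReal.coe_le_coe_iff] at hle ⊢
  exact exists_ramanaFeasible_le hA hB hx hle

end Duality

end RamanaDual

theorem theorem1 {m n : ℕ} (A : Fin m → Matrix (Fin n) (Fin n) ℝ)
    (B : Matrix (Fin n) (Fin n) ℝ) (c : Fin m → ℝ)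
    (hA : ∀ i, (A i).IsSymm) (hB : B.IsSymm)
    (hfeas : (RamanaDual.primalFeasible A B).Nonempty) :
    RamanaDual.valPrimal A B c = RamanaDual.valRamana A B c ∧
      (RamanaDual.valRamana A B c ≠ ⊥ → RamanaDual.valRamana A B c ≠ ⊤ →
        ∃ U V : Fin (n + 2) → Matrix (Fin n) (Fin n) ℝ,
          RamanaDual.RamanaFeasible A B c U V ∧
            ((RamanaDual.ramanaObjective B U V : ℝ) : EReal) =
              RamanaDual.valRamana A B c) := by
  obtain ⟨x, hx⟩ := hfeas
  have hweak := RamanaDual.valPrimal_le_valRamana (A := A) (B := B) (c := c)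
  by_cases htop : RamanaDual.valPrimal A B c = ⊤
  · have htop' := top_le_iff.mp (htop ▸ hweak)
    exact ⟨htop.trans htop'.symm, fun _ h ↦ absurd htop' h⟩
  obtain ⟨U, V, hUV, hle⟩ :=
    RamanaDual.exists_ramanaFeasible_le_valPrimal hA hB hx htop
  have hinf : RamanaDual.valRamana A B c ≤ ((RamanaDual.ramanaObjective B U V : ℝ) : EReal) :=
    iInf₂_le_of_le U V (iInf_le _ hUV)
  exact ⟨hweak.antisymm (hinf.trans hle), fun _ _ ↦ ⟨U, V, hUV, (hle.trans hweak).antisymm hinf⟩⟩
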